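/- Let $\mathbb X$ be a locally compact Hausdorff space with a countable base and its Borel $\sigma$-algebra, let $\{x_t\}_{t\ge 0}$ be a càdlàg time-homogeneous strong Markov process on $\mathbb X$, where $\mathbb E_x$ is the expectation for the process started at $x$, and let $\mu$ be a stationary probability measure of it. Write $\|f\|_\mu=(\int f^2\,d\mu)^{1/2}$ for the norm of $L^2_\mu$ (real-valued functions). Let $P_tf(x)=\mathbb E_x[f(x_t)]$ be the Markov semigroup on $L^2_\mu$ and $\mathcal A f=\lim_{t\downarrow 0}(P_tf-f)/t$ (limit in $L^2_\mu$) its infinitesimal generator, with domain $D(\mathcal A)\subseteq L^2_\mu$. Let $\gamma>0$, $r\in L^2_\mu$, $\mathcal T=\mathcal A-\gamma$, and let $$V^*(x)=\mathbb E_x\Big[\int_0^\infty e^{-\gamma t}r(x_t)\,dt\Big].$$ Let $K$ be a continuous symmetric positive semidefinite kernel on $\mathbb X$ with $K(\cdot,x)\in L^2_\mu$ for all $x$, let $\mathcal H$ be its reproducing kernel Hilbert space, and put $\Pi V(x)=\int_{\mathbb X}V(z)K(z,x)\,d\mu(z)$ for $V\in L^2_\mu$. Assume that $\mathcal H\subseteq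 D(\mathcal A)$ and that $\Pi$ is the orthogonal projection of $L^2_\mu$ onto $\mathcal H$, that is, for all $V\in L^2_\mu$ and $h\in\mathcal H$, $\Pi V\in\mathcal H$, $\Pi h=h$ (as functions on $\mathbb X$) and $V-\Pi V\perp h$ in $L^2_\mu$. Then for $\mu$-almost every $x$ the integral defining $V^*(x)$ converges absolutely, and $V^*\in L^2_\mu$. There is a unique $V_\infty\in\mathcal H$ with $\Pi(\mathcal TV_\infty+r)=0$, and $$\|V_\infty-V^*\|_\mu\le\gamma^{-1}\|\mathcal TV_\infty+r\|_\mu .$$ For every $V_0\in\mathcal H$ the evolution equation $$\partial_tV_t=\Pi(\mathcal TV_t+r),\qquad t\ge 0,$$ has a unique (differentiable) solution $V:[0,\infty)\to\mathcal H$ with initial value $V_0$. The equilibrium $V_\infty$ is globally exponentially stable in $\mathcal H$: $\|V_t-V_\infty\|_{\mathcal H}\le e^{-\gamma t}\|V_0-V_\infty\|_{\mathcal H}$ for all $t\ge 0$. Moreover, for all $t\ge 0$, $$\|V_t-V^*\|_\mu\le e^{-\gamma t}\|V_0-V_\infty\|_\mu+\frac1\gamma\|\mathcal TV_\infty+r\|_\mu,$$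 $$\|V_t-V^*\|_\mu\le e^{-\gamma t}\|V_0-V^*\|_\mu+\frac{1-e^{-\gamma t}}{\gamma}\sup_{s\in[0,t]}\|(\Pi-\mathrm{id})(\mathcal TV_s+r)\|_\mu,$$ where the supremum is finite. -/

import Mathlib

open MeasureTheory ProbabilityTheory Filter Topology Set
open scoped NNReal ENNReal

noncomputable section

/-- A càdlàg, time-homogeneous strong Markov process with state space `E`, realized as a Markov
family: `law x` is the law on `Ω` of the process started at `x`. -/
structure StrongMarkovProcess (E Ω : Type*) [TopologicalSpace E] [MeasurableSpace E]
    [mΩ : MeasurableSpace Ω] where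
  /-- The state at time `t`. -/
  path : ℝ≥0 → Ω → E
  /-- The filtration with respect to which the strong Markov property holds. -/
  filtration : Filtration ℝ≥0 mΩ
  /-- The law of the process started at a given point. -/
  law : Kernel E Ω
  isMarkovKernel_law : IsMarkovKernel law
  adapted : Adapted filtration path
  /-- Paths are right continuous and have left limits. -/
  cadlag : ∀ (ω : Ω) (t : ℝ≥0), ContinuousWithinAt (fun s => path s ω) (Ici t) t ∧
    ∃ l : E, Tendsto (fun s => path s ω) (𝓝[<] t) (𝓝 l)
  initial : ∀ x : E, ∀ᵐ ω ∂(law x), path 0 ω = x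
  /-- Strong Markov property and homogeneity: for a stopping time `τ`, on `{τ < ∞}` the conditional
  law of `X (τ + t)` given the past up to `τ` is the law of `X t` started at `X τ`. -/
  strongMarkov : ∀ (x : E) (τ : Ω → WithTop ℝ≥0) (hτ : IsStoppingTime filtration τ) (t : ℝ≥0)
    (F : Set Ω) (B : Set E), MeasurableSet[hτ.measurableSpace] F → (∀ ω ∈ F, τ ω ≠ ⊤) →
    MeasurableSet B →
    law x (F ∩ {ω | path ((τ ω).untopD 0 + t) ω ∈ B}) =
      ∫⁻ ω in F, law (path ((τ ω).untopD 0) ω) {ω' | path t ω' ∈ B} ∂(law x)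

namespace StrongMarkovProcess

variable {E Ω : Type*} [TopologicalSpace E] [MeasurableSpace E] [MeasurableSpace Ω]

/-- `μ` is a stationary distribution of the process. -/
def IsStationary (X : StrongMarkovProcess E Ω) (μ : Measure E) : Prop :=
  ∀ t : ℝ≥0, (X.law.map (X.path t)).Invariant μ

/-- The Markov semigroup `P_t f (x) = E_x [f (x_t)]`. -/
def semigroup (X : StrongMarkovProcess E Ω) (t : ℝ≥0) (f : E → ℝ) (x : E) : ℝ :=
  ∫ ω, f (X.path t ω) ∂(X.law x)

/-- `f` is in the domain of the infinitesimal generator of the semigroup on `L²(μ)`, and the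
generator maps `f` to `g`, i.e. `(P_t f - f) / t → g` in `L²(μ)` as `t → 0+`. -/
def HasGenerator (X : StrongMarkovProcess E Ω) (μ : Measure E) (f : E → ℝ) (g : Lp ℝ 2 μ) : Prop :=
  MemLp f 2 μ ∧
    Tendsto (fun t : ℝ≥0 => eLpNorm (fun x => (X.semigroup t f x - f x) / (t : ℝ) - g x) 2 μ)
      (𝓝[>] 0) (𝓝 0)

/-- The domain `D(A) ⊆ L²(μ)` of the infinitesimal generator. -/
def InDomain (X : StrongMarkovProcess E Ω) (μ : Measure E) (f : E → ℝ) : Prop :=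
  ∃ g : Lp ℝ 2 μ, X.HasGenerator μ f g

open Classical in
/-- The infinitesimal generator `A` on `L²(μ)`; the value is `0` outside the domain. -/
def generator (X : StrongMarkovProcess E Ω) (μ : Measure E) (f : E → ℝ) : Lp ℝ 2 μ :=
  if h : X.InDomain μ f then h.choose else 0

/-- The function `T f + r`, where `T = A - γ`. -/
def bellman (X : StrongMarkovProcess E Ω) (μ : Measure E) (γ : ℝ) (r f : E → ℝ) (x : E) : ℝ :=
  X.generator μ f x - γ * f x + r x

/-- The value function `V*(x) = E_x [∫₀^∞ e^{-γ t} r(x_t) dt]`. -/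
def valueFunction (X : StrongMarkovProcess E Ω) (γ : ℝ) (r : E → ℝ) (x : E) : ℝ :=
  ∫ ω, (∫ t in Ioi (0 : ℝ), Real.exp (-γ * t) * r (X.path t.toNNReal ω)) ∂(X.law x)

end StrongMarkovProcess

/-- The norm `‖f‖_μ` of `L²(μ)`. -/
def l2norm {E : Type*} [MeasurableSpace E] (μ : Measure E) (f : E → ℝ) : ℝ :=
  √(∫ x, f x ^ 2 ∂μ)

/-- The integral operator `Π V (x) = ∫ V(z) K(z, x) dμ(z)`. -/
def kernelOp {E : Type*} [MeasurableSpace E] (μ : Measure E) (K : E → E → ℝ) (V : E → ℝ) (x : E) :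
    ℝ :=
  ∫ z, V z * K z x ∂μ

/-- `K` is the reproducing kernel of the Hilbert space `H` of real functions on `E`
(so `K` is automatically symmetric and positive semidefinite). -/
def IsKernelOf {E : Type*} (K : E → E → ℝ) (H : Type*) [NormedAddCommGroup H]
    [InnerProductSpace ℝ H] [CompleteSpace H] [RKHS ℝ H E ℝ] : Prop :=
  ∀ x y : E, RKHS.kernel H x y 1 = K x y

/-- The integral operator with kernel `K` is the orthogonal projection of `L²(μ)` onto the space of
functions `H`. -/
structure IsOrthProjOnto {E : Type*} [MeasurableSpace E] (μ : Measure E) (K : E → E → ℝ)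
    (H : Type*) [NormedAddCommGroup H] [InnerProductSpace ℝ H] [RKHS ℝ H E ℝ] : Prop where
  mapsTo : ∀ V : E → ℝ, MemLp V 2 μ → ∃ h : H, ⇑h = kernelOp μ K V
  apply_eq : ∀ h : H, kernelOp μ K h = ⇑h
  orthogonal : ∀ V : E → ℝ, MemLp V 2 μ → ∀ h : H, ∫ x, (V x - kernelOp μ K V x) * h x ∂μ = 0

/-- `V : [0, ∞) → H` solves `∂_t V_t = Π (T V_t + r)` in `H` with initial value `V₀`; at `t = 0` the
derivative is one-sided. -/
def IsProjectedSolution {E Ω : Type*} [TopologicalSpace E] [MeasurableSpace E] [MeasurableSpace Ω]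
    (X : StrongMarkovProcess E Ω) (μ : Measure E) (K : E → E → ℝ) (γ : ℝ) (r : E → ℝ)
    {H : Type*} [NormedAddCommGroup H] [InnerProductSpace ℝ H] [RKHS ℝ H E ℝ]
    (V₀ : H) (V : ℝ → H) : Prop :=
  V 0 = V₀ ∧ ∀ t : ℝ, 0 ≤ t → ∃ D : H, HasDerivWithinAt V D (Ici 0) t ∧
    ⇑D = kernelOp μ K (X.bellman μ γ r (V t))

end

/-! Let `j` be the inclusion of `H` into `L²(μ)`. By the reproducing property its adjoint is the
kernel operator `Π`, and `Π h = h` says `j* j = 1`, so `j` is an isometry and the norms of `H` and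
`L²(μ)` agree on `H`. Since the difference quotients of the semigroup converge at every point of
`H`, Banach–Steinhaus makes the generator bounded from `H` to `L²(μ)`. The projected equation is
therefore an affine ODE `V' = M V + b` with bounded `M = j* A - γ`.

By stationarity and Jensen, `P_t` is a contraction of `L²(μ)`, hence `⟪A h, h⟫ ≤ 0` and `⟪M h, h⟫ ≤
-γ ‖h‖²`. Lax–Milgram then gives the equilibrium, the operator exponential gives solutions, and an
energy estimate gives uniqueness and exponential stability (`norm_le_exp_mul_of_dissipative`).

For the distance to `V*`, put `S t = e^{-γ t} P_t`. Then `V* = ∫₀^∞ S t r dt` weakly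
(`inner_valueFunction`), and `V_t` solves `u' = T u + r` up to the projection error `ε`. Duhamel's
formula `u t - V* = S t (u 0 - V*) + ∫₀ᵗ S τ (ε (t - τ)) dτ`, taken weakly, yields the bound with
the supremum (`norm_sub_le_of_perturbed`). Applied to the constant path at the equilibrium, it also
gives the equilibrium error; the remaining bound is the triangle inequality. Neither `V* ∈ D(A)` nor
strong continuity on all of `L²(μ)` is needed. -/

/-! ### Discounted contraction semigroups and Duhamel's formula. -/

section Hilbert

open scoped InnerProductSpace

variable {L H : Type*} [NormedAddCommGroup L] [InnerProductSpace ℝ L]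
  [NormedAddCommGroup H] [InnerProductSpace ℝ H]

/-- A one-parameter semigroup `S` (indexed by `t ≥ 0`) with `‖S t‖ ≤ exp (-γ t)`. No continuity is
assumed. -/
structure IsDecayingSemigroup (γ : ℝ) (S : ℝ → L →L[ℝ] L) : Prop where
  zero : S 0 = 1
  add : ∀ s t, 0 ≤ s → 0 ≤ t → S (s + t) = S s * S t
  norm_le : ∀ t, 0 ≤ t → ∀ f, ‖S t f‖ ≤ Real.exp (-γ * t) * ‖f‖

namespace IsDecayingSemigroup

variable {γ : ℝ} {S : ℝ → L →L[ℝ] L}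

lemma norm_apply_le (hS : IsDecayingSemigroup γ S) (hγ : 0 ≤ γ) {t : ℝ} (ht : 0 ≤ t) (f : L) :
    ‖S t f‖ ≤ ‖f‖ := by
  refine (hS.norm_le t ht f).trans (mul_le_of_le_one_left (norm_nonneg _) ?_)
  exact Real.exp_le_one_iff.2 (by nlinarith)

lemma apply_add (hS : IsDecayingSemigroup γ S) {s t : ℝ} (hs : 0 ≤ s) (ht : 0 ≤ t) (f : L) :
    S (s + t) f = S s (S t f) := by
  rw [hS.add s t hs ht]; rfl

lemma tendsto_apply_of_tendsto_slope {f g : L}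
    (h : Tendsto (fun t : ℝ => t⁻¹ • (S t f - f)) (𝓝[>] 0) (𝓝 g)) :
    Tendsto (fun t => S t f) (𝓝[>] 0) (𝓝 f) := by
  have h0 : Tendsto (fun t : ℝ => t) (𝓝[>] 0) (𝓝 0) := tendsto_nhdsWithin_of_tendsto_nhds tendsto_id
  have h1 := (h0.smul h).add_const f
  rw [zero_smul, zero_add] at h1
  refine h1.congr' ?_
  filter_upwards [self_mem_nhdsWithin] with t ht
  rw [smul_smul, mul_inv_cancel₀ (ne_of_gt ht), one_smul, sub_add_cancel]

lemma tendsto_apply_apply (hS : IsDecayingSemigroup γ S) (hγ : 0 ≤ γ) {w : ℝ → L} {f : L}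
    (hf : Tendsto (fun t => S t f) (𝓝[>] 0) (𝓝 f)) (hw : Tendsto w (𝓝[>] 0) (𝓝 f)) :
    Tendsto (fun t => S t (w t)) (𝓝[>] 0) (𝓝 f) := by
  have h1 : Tendsto (fun t => S t (w t - f)) (𝓝[>] 0) (𝓝 0) := by
    refine squeeze_zero_norm' ?_ (tendsto_iff_norm_sub_tendsto_zero.1 hw)
    filter_upwards [self_mem_nhdsWithin] with t ht using hS.norm_apply_le hγ (le_of_lt ht) _
  simpa using h1.add hf

/-- The semigroup law and contractivity give `‖S b f - S a f‖ ≤ ‖S |b - a| f - f‖`, so right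
continuity at `0` propagates to two-sided continuity at every time. -/
lemma continuousOn_apply (hS : IsDecayingSemigroup γ S) (hγ : 0 ≤ γ) {f : L}
    (hf : Tendsto (fun t => S t f) (𝓝[>] 0) (𝓝 f)) :
    ContinuousOn (fun t => S t f) (Ici 0) := by
  have key : ∀ a b, 0 ≤ a → a ≤ b → ‖S b f - S a f‖ ≤ ‖S (b - a) f - f‖ := fun a b ha hab => by
    have : S b f - S a f = S a (S (b - a) f - f) := by
      rw [map_sub, ← hS.apply_add ha (sub_nonneg.2 hab), add_sub_cancel]
    rw [this]
    exact hS.norm_apply_le hγ ha _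
  have hf' : Tendsto (fun t => S t f) (𝓝[≥] 0) (𝓝 f) := by
    rw [← Ioi_insert, nhdsWithin_insert, tendsto_sup]
    refine ⟨?_, hf⟩
    rw [tendsto_pure_left]
    intro s hs
    simpa [hS.zero] using mem_of_mem_nhds hs
  intro a ha
  have habs : Tendsto (fun b => |b - a|) (𝓝[Ici 0] a) (𝓝[≥] 0) := by
    refine tendsto_nhdsWithin_iff.2 ⟨?_, Eventually.of_forall fun b => mem_Ici.2 (abs_nonneg _)⟩
    have : Continuous fun b : ℝ => |b - a| := by fun_prop
    simpa using (this.tendsto a).mono_left nhdsWithin_le_nhds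
  have h2 := tendsto_iff_norm_sub_tendsto_zero.1 (hf'.comp habs)
  refine tendsto_iff_norm_sub_tendsto_zero.2 (squeeze_zero' (Eventually.of_forall fun _ =>
    norm_nonneg _) ?_ h2)
  filter_upwards [self_mem_nhdsWithin] with b hb
  rcases le_total a b with hab | hab
  · simpa [abs_of_nonneg (sub_nonneg.2 hab)] using key a b ha hab
  · rw [norm_sub_rev]
    simpa [abs_of_nonpos (sub_nonpos.2 hab)] using key b a hb hab

/-- Product rule: the increment over `h` is `S τ` applied to `(S h u - u) + S h (u (t - τ - h) -
u)`, with `u` taken at `t - τ`. Only right derivatives are available, because the slopes of `S` are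
known only as `h ↓ 0`. -/
lemma hasDerivWithinAt_apply_reversed (hS : IsDecayingSemigroup γ S) (hγ : 0 ≤ γ)
    {u : ℝ → L} {f' u' : L} {t τ : ℝ} (hτ : 0 ≤ τ) (hu : HasDerivAt u u' (t - τ))
    (hf : Tendsto (fun h : ℝ => h⁻¹ • (S h (u (t - τ)) - u (t - τ))) (𝓝[>] 0) (𝓝 f'))
    (hu' : Tendsto (fun h => S h u') (𝓝[>] 0) (𝓝 u')) :
    HasDerivWithinAt (fun s => S s (u (t - s))) (S τ (f' - u')) (Ioi τ) τ := by
  have hmap : 𝓝[>] τ = map (fun h => τ + h) (𝓝[>] 0) := by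
    simp
  rw [hasDerivWithinAt_iff_tendsto_slope' self_notMem_Ioi, hmap, tendsto_map'_iff]
  have hq : Tendsto (fun h : ℝ => h⁻¹ • (u (t - (τ + h)) - u (t - τ))) (𝓝[>] 0) (𝓝 (-u')) := by
    have h1 : HasDerivAt (fun h : ℝ => u (t - (τ + h))) (-u') 0 := by
      have h2 : HasDerivAt (fun h : ℝ => t - (τ + h)) (-1) 0 := by
        simpa using ((hasDerivAt_id (0 : ℝ)).const_add τ).const_sub t
      have h3 : HasDerivAt u u' ((fun h : ℝ => t - (τ + h)) 0) := by simpa using hu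
      simpa [Function.comp_def] using h3.scomp (0 : ℝ) h2
    have h4 := (hasDerivAt_iff_tendsto_slope_zero.1 h1).mono_left
      (nhdsWithin_mono 0 (fun x (hx : x ∈ Ioi 0) => ne_of_gt hx))
    simpa using h4
  have hneg : Tendsto (fun h => S h (-u')) (𝓝[>] 0) (𝓝 (-u')) := by simpa using hu'.neg
  have h5 := (S τ).continuous.tendsto _ |>.comp (hf.add (hS.tendsto_apply_apply hγ hneg hq))
  rw [← sub_eq_add_neg] at h5
  refine h5.congr' ?_
  filter_upwards [self_mem_nhdsWithin] with h hh
  simp only [Function.comp_apply, slope_def_module, add_sub_cancel_left,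
    hS.apply_add hτ (le_of_lt hh)]
  rw [map_smul, ← smul_add, map_smul, map_sub, ← map_sub (S τ)]
  congr 2
  abel

/-- Stability of the evolution equation `u' = T u + r` on `L` under a perturbation of size `M`,
relative to the stationary mild solution `v = ∫₀^∞ S t r dt`. -/
theorem norm_sub_le_of_perturbed (hS : IsDecayingSemigroup γ S) (hγ : 0 < γ) {D : Set L}
    {T : L → L} (hT : ∀ f ∈ D, Tendsto (fun h : ℝ => h⁻¹ • (S h f - f)) (𝓝[>] 0) (𝓝 (T f)))
    {r v : L}
    (hint : ∀ g, IntegrableOn (fun τ => ⟪g, S τ r⟫_ℝ) (Ioi 0))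
    (hv : ∀ g, ⟪g, v⟫_ℝ = ∫ τ in Ioi 0, ⟪g, S τ r⟫_ℝ)
    {u u' : ℝ → L} (huD : ∀ s, 0 ≤ s → u s ∈ D) (huD' : ∀ s, 0 ≤ s → u' s ∈ D)
    (hu : ∀ s, 0 ≤ s → HasDerivWithinAt u (u' s) (Ici 0) s)
    {t M : ℝ} (ht : 0 ≤ t) (hM : ∀ s ∈ Icc 0 t, ‖u' s - T (u s) - r‖ ≤ M) [CompleteSpace L] :
    ‖u t - v‖ ≤ Real.exp (-γ * t) * ‖u 0 - v‖ + (1 - Real.exp (-γ * t)) / γ * M := by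
  have hcont0 : ∀ f ∈ D, Tendsto (fun h => S h f) (𝓝[>] 0) (𝓝 f) := fun f hf =>
    tendsto_apply_of_tendsto_slope (hT f hf)
  have hM0 : 0 ≤ M := (norm_nonneg _).trans (hM 0 ⟨le_rfl, ht⟩)
  -- The Duhamel path runs from `u t` at `τ = 0` to `S t (u 0)` at `τ = t`; its right derivative is
  -- `-S τ (ε (t - τ)) - S τ r`.
  set Φ : ℝ → L := fun τ => S τ (u (t - τ)) with hΦ
  set ε : ℝ → L := fun s => u' s - T (u s) - r with hε
  have hΦcont : ContinuousOn Φ (Icc 0 t) := by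
    intro τ hτ
    have huc : ContinuousWithinAt (fun s => u (t - s)) (Icc 0 t) τ := by
      have h1 := (hu (t - τ) (sub_nonneg.2 hτ.2)).continuousWithinAt
      refine ContinuousWithinAt.comp (t := Ici 0) (f := fun s => t - s) h1
        (by fun_prop) fun s hs => sub_nonneg.2 hs.2
    have h2 := (hS.continuousOn_apply hγ.le
      (hcont0 _ (huD (t - τ) (sub_nonneg.2 hτ.2))) τ hτ.1).mono (Icc_subset_Ici_self : Icc 0 t ⊆ Ici 0)
    have h3 : Tendsto (fun s => S s (u (t - s) - u (t - τ))) (𝓝[Icc 0 t] τ) (𝓝 0) := by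
      refine squeeze_zero_norm' ?_ (tendsto_iff_norm_sub_tendsto_zero.1 huc)
      filter_upwards [self_mem_nhdsWithin] with s hs using hS.norm_apply_le hγ.le hs.1 _
    have h4 := h3.add h2
    rw [zero_add] at h4
    exact h4.congr fun s => by simp [hΦ]
  have hΦderiv : ∀ τ ∈ Ioo 0 t,
      HasDerivWithinAt Φ (S τ (T (u (t - τ)) - u' (t - τ))) (Ioi τ) τ := by
    intro τ hτ
    have hpos : 0 < t - τ := sub_pos.2 hτ.2
    exact hS.hasDerivWithinAt_apply_reversed hγ.le hτ.1.le
      ((hu _ hpos.le).hasDerivAt (Ici_mem_nhds hpos)) (hT _ (huD _ hpos.le))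
      (hcont0 _ (huD' _ hpos.le))
  have hform : ∀ τ, S τ (T (u (t - τ)) - u' (t - τ)) = -(S τ (ε (t - τ))) - S τ r := by
    intro τ
    rw [← map_neg, ← map_sub]
    congr 1
    simp only [hε]
    abel
  have hεb : ∀ τ ∈ Icc 0 t, ‖S τ (ε (t - τ))‖ ≤ Real.exp (-γ * τ) * M := fun τ hτ =>
    (hS.norm_le τ hτ.1 _).trans (mul_le_mul_of_nonneg_left
      (hM _ ⟨sub_nonneg.2 hτ.2, by linarith [hτ.1]⟩) (Real.exp_pos _).le)
  -- Testing against `g` keeps all integrals scalar, as `v` is given only weakly.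
  have key : ∀ g : L, ⟪g, (u t - v) - S t (u 0 - v)⟫_ℝ ≤
      ‖g‖ * ((1 - Real.exp (-γ * t)) / γ * M) := by
    intro g
    have hderiv : ∀ τ ∈ Ioo 0 t, HasDerivWithinAt (fun s => ⟪g, Φ s⟫_ℝ)
        ⟪g, S τ (T (u (t - τ)) - u' (t - τ))⟫_ℝ (Ioi τ) τ := fun τ hτ =>
      (innerSL ℝ g).hasFDerivAt.comp_hasDerivWithinAt τ (hΦderiv τ hτ)
    have hrint : IntervalIntegrable (fun τ => ⟪g, S τ r⟫_ℝ) volume 0 t :=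
      (intervalIntegrable_iff_integrableOn_Ioc_of_le ht).2
        ((hint g).mono_set Ioc_subset_Ioi_self)
    -- Measurability in `τ` comes for free: the integrand is a right derivative.
    have hmeas : AEStronglyMeasurable
        (fun τ => ⟪g, S τ (T (u (t - τ)) - u' (t - τ))⟫_ℝ) (volume.restrict (Ioo 0 t)) := by
      refine (stronglyMeasurable_derivWithin_Ioi (fun s => ⟪g, Φ s⟫_ℝ)).aestronglyMeasurable.congr ?_
      filter_upwards [ae_restrict_mem measurableSet_Ioo] with τ hτ
      exact (hderiv τ hτ).derivWithin (uniqueDiffWithinAt_Ioi τ)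
    have hψint : IntervalIntegrable (fun τ => ⟪g, S τ (T (u (t - τ)) - u' (t - τ))⟫_ℝ)
        volume 0 t := by
      rw [intervalIntegrable_iff_integrableOn_Ioo_of_le ht]
      refine Integrable.of_bound hmeas (‖g‖ * (M + ‖r‖)) ?_
      filter_upwards [ae_restrict_mem measurableSet_Ioo] with τ hτ
      refine (norm_inner_le_norm _ _).trans (mul_le_mul_of_nonneg_left ?_ (norm_nonneg _))
      refine (hS.norm_apply_le hγ.le hτ.1.le _).trans ?_
      have := hM (t - τ) ⟨sub_nonneg.2 hτ.2.le, by linarith [hτ.1]⟩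
      rw [show T (u (t - τ)) - u' (t - τ) = -(u' (t - τ) - T (u (t - τ)) - r) - r by abel]
      refine (norm_sub_le _ _).trans ?_
      rw [norm_neg]
      linarith
    have hftc := intervalIntegral.integral_eq_sub_of_hasDeriv_right_of_le ht
      ((innerSL ℝ g).continuous.comp_continuousOn hΦcont) hderiv hψint
    have hεint : IntervalIntegrable (fun τ => ⟪g, S τ (ε (t - τ))⟫_ℝ) volume 0 t := by
      refine (hψint.add hrint).neg.congr ?_
      intro τ _
      simp [hform, inner_sub_right]
    have hsplit : ∫ τ in (0 : ℝ)..t, ⟪g, S τ (T (u (t - τ)) - u' (t - τ))⟫_ℝ =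
        -(∫ τ in (0 : ℝ)..t, ⟪g, S τ (ε (t - τ))⟫_ℝ) - ∫ τ in (0 : ℝ)..t, ⟪g, S τ r⟫_ℝ := by
      rw [← intervalIntegral.integral_neg]
      simp only [hform, inner_sub_right, inner_neg_right]
      exact intervalIntegral.integral_sub hεint.neg hrint
    -- Moving `S t` to the other side by its adjoint shifts the integral defining `v` to `(t, ∞)`.
    have hvt : ⟪g, v⟫_ℝ - ⟪g, S t v⟫_ℝ = ∫ τ in (0 : ℝ)..t, ⟪g, S τ r⟫_ℝ := by
      have h1 : ⟪g, S t v⟫_ℝ = ∫ τ in Ioi t, ⟪g, S τ r⟫_ℝ := by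
        rw [← ContinuousLinearMap.adjoint_inner_left, hv]
        have h2 := (measurePreserving_add_right (volume : Measure ℝ) t).setIntegral_preimage_emb
          (measurableEmbedding_addRight t) (fun τ => ⟪g, S τ r⟫_ℝ) (Ioi t)
        rw [← h2, preimage_add_const_Ioi, sub_self]
        refine setIntegral_congr_fun measurableSet_Ioi fun τ hτ => ?_
        simp only [ContinuousLinearMap.adjoint_inner_left]
        rw [← hS.apply_add ht (le_of_lt hτ), add_comm]
      rw [h1, hv, intervalIntegral.integral_of_le ht, ← Ioc_union_Ioi_eq_Ioi ht,
        setIntegral_union (Ioc_disjoint_Ioi le_rfl) measurableSet_Ioi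
          ((hint g).mono_set Ioc_subset_Ioi_self) ((hint g).mono_set (Ioi_subset_Ioi ht))]
      ring
    have hexp : ∫ τ in (0 : ℝ)..t, ‖g‖ * (Real.exp (-γ * τ) * M) =
        ‖g‖ * ((1 - Real.exp (-γ * t)) / γ * M) := by
      rw [intervalIntegral.integral_const_mul, intervalIntegral.integral_mul_const,
        intervalIntegral.integral_comp_mul_left (fun x => Real.exp x) (neg_ne_zero.2 hγ.ne')]
      simp only [integral_exp, mul_zero, Real.exp_zero, smul_eq_mul]
      field_simp
      ring
    have hle : ∫ τ in (0 : ℝ)..t, ⟪g, S τ (ε (t - τ))⟫_ℝ ≤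
        ‖g‖ * ((1 - Real.exp (-γ * t)) / γ * M) := by
      rw [← hexp]
      refine intervalIntegral.integral_mono_on ht hεint
        (Continuous.intervalIntegrable (by fun_prop) _ _) fun τ hτ => ?_
      exact (real_inner_le_norm _ _).trans
        (mul_le_mul_of_nonneg_left (hεb τ hτ) (norm_nonneg _))
    have hend : ⟪g, Φ t⟫_ℝ - ⟪g, Φ 0⟫_ℝ = ⟪g, S t (u 0)⟫_ℝ - ⟪g, u t⟫_ℝ := by
      simp [hΦ, hS.zero]
    simp only [Function.comp_apply, innerSL_apply_apply] at hftc
    rw [hsplit, hend] at hftc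
    simp only [inner_sub_right, map_sub]
    linarith
  have hmain : ‖(u t - v) - S t (u 0 - v)‖ ≤ (1 - Real.exp (-γ * t)) / γ * M := by
    -- Testing with `g = w` itself and dividing by `‖w‖` recovers the norm bound.
    set w := (u t - v) - S t (u 0 - v) with hw
    have h1 := key w
    rw [real_inner_self_eq_norm_sq, sq] at h1
    rcases (norm_nonneg w).eq_or_lt with h0 | h0
    · rw [← h0]
      have : Real.exp (-γ * t) ≤ 1 := Real.exp_le_one_iff.2 (by nlinarith)
      exact mul_nonneg (div_nonneg (by linarith) hγ.le) hM0
    · exact le_of_mul_le_mul_left h1 h0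
  calc ‖u t - v‖ = ‖S t (u 0 - v) + ((u t - v) - S t (u 0 - v))‖ := by congr 1; abel
    _ ≤ _ := (norm_add_le _ _).trans (add_le_add (hS.norm_le t ht _) hmain)

end IsDecayingSemigroup
end Hilbert

/-! ### Dissipativity and affine ODEs in a Hilbert space. -/

section Hilbert

open scoped InnerProductSpace

variable {L H : Type*} [NormedAddCommGroup L] [InnerProductSpace ℝ L]
  [NormedAddCommGroup H] [InnerProductSpace ℝ H]

namespace IsDecayingSemigroup

lemma exp_smul {P : ℝ → L →L[ℝ] L} (hP : IsDecayingSemigroup 0 P) (γ : ℝ) :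
    IsDecayingSemigroup γ (fun t => Real.exp (-γ * t) • P t) where
  zero := by simp [hP.zero]
  add s t hs ht := by
    rw [hP.add s t hs ht, smul_mul_smul_comm, ← Real.exp_add]
    ring_nf
  norm_le t ht f := by
    have := hP.norm_le t ht f
    simp only [neg_zero, zero_mul, Real.exp_zero, one_mul] at this
    simp only [FunLike.coe_smul, Pi.smul_apply, norm_smul, Real.norm_eq_abs, Real.abs_exp]
    exact mul_le_mul_of_nonneg_left this (Real.exp_pos _).le

lemma tendsto_slope_exp_smul {P : ℝ → L →L[ℝ] L} {f g : L} (γ : ℝ)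
    (h : Tendsto (fun t : ℝ => t⁻¹ • (P t f - f)) (𝓝[>] 0) (𝓝 g)) :
    Tendsto (fun t : ℝ => t⁻¹ • ((Real.exp (-γ * t) • P t) f - f)) (𝓝[>] 0) (𝓝 (g - γ • f)) := by
  have hd : HasDerivAt (fun t : ℝ => Real.exp (-γ * t)) (-γ) 0 := by
    simpa using ((hasDerivAt_id (0 : ℝ)).const_mul (-γ)).exp
  have hexp : Tendsto (fun t : ℝ => Real.exp (-γ * t)) (𝓝[>] 0) (𝓝 1) := by
    simpa using hd.continuousAt.tendsto.mono_left nhdsWithin_le_nhds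
  have hs : Tendsto (fun t : ℝ => t⁻¹ • (Real.exp (-γ * t) - 1)) (𝓝[>] 0) (𝓝 (-γ)) := by
    refine ((hasDerivWithinAt_iff_tendsto_slope' self_notMem_Ioi).1
      (hd.hasDerivWithinAt (s := Ioi 0))).congr fun t => ?_
    simp [slope_def_module]
  have := (hexp.smul h).add (hs.smul_const f)
  rw [one_smul, neg_smul, ← sub_eq_add_neg] at this
  refine this.congr fun t => ?_
  simp only [FunLike.coe_smul, Pi.smul_apply]
  module

/-- By Cauchy–Schwarz and contractivity, `⟪P t f - f, f⟫ ≤ ‖P t f‖ ‖f‖ - ‖f‖² ≤ 0`. -/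
lemma inner_slope_nonpos {P : ℝ → L →L[ℝ] L} (hP : IsDecayingSemigroup 0 P) {f g : L}
    (h : Tendsto (fun t : ℝ => t⁻¹ • (P t f - f)) (𝓝[>] 0) (𝓝 g)) : ⟪g, f⟫_ℝ ≤ 0 := by
  refine le_of_tendsto (h.inner tendsto_const_nhds) ?_
  filter_upwards [self_mem_nhdsWithin] with t ht
  rw [real_inner_smul_left, inner_sub_left, real_inner_self_eq_norm_sq]
  have h1 := real_inner_le_norm (P t f) f
  have h2 := hP.norm_apply_le le_rfl (le_of_lt ht) f
  have h3 : 0 ≤ t⁻¹ := inv_nonneg.2 (le_of_lt ht)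
  refine mul_nonpos_of_nonneg_of_nonpos h3 ?_
  nlinarith [norm_nonneg f]

end IsDecayingSemigroup

/-- Solutions of `u' = M u` decay exponentially if `M + γ` is dissipative. -/
lemma norm_le_exp_mul_of_dissipative {γ : ℝ} {M : H →L[ℝ] H}
    (hM : ∀ h, ⟪M h, h⟫_ℝ ≤ -γ * ‖h‖ ^ 2) {u : ℝ → H}
    (hu : ∀ t, 0 ≤ t → HasDerivWithinAt u (M (u t)) (Ici 0) t) {t : ℝ} (ht : 0 ≤ t) :
    ‖u t‖ ≤ Real.exp (-γ * t) * ‖u 0‖ := by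
  -- The squared norm decays at rate `2γ`, so this weighted energy is nonincreasing.
  set f : ℝ → ℝ := fun s => Real.exp (2 * γ * s) * ‖u s‖ ^ 2 with hf
  have hd : ∀ s, 0 ≤ s → HasDerivWithinAt f (Real.exp (2 * γ * s) * (2 * γ) * ‖u s‖ ^ 2 +
      Real.exp (2 * γ * s) * (2 * ⟪u s, M (u s)⟫_ℝ)) (Ici 0) s := fun s hs => by
    have h1 : HasDerivWithinAt (fun s : ℝ => Real.exp (2 * γ * s))
        (Real.exp (2 * γ * s) * (2 * γ)) (Ici 0) s := by
      simpa using (((hasDerivAt_id s).const_mul (2 * γ)).exp).hasDerivWithinAt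
    exact h1.mul (hu s hs).norm_sq
  have hanti : AntitoneOn f (Ici 0) := by
    refine antitoneOn_of_deriv_nonpos (convex_Ici 0) (fun s hs => (hd s hs).continuousWithinAt)
      (fun s hs => ?_) (fun s hs => ?_)
    · exact ((hd s (interior_subset hs)).mono interior_subset).differentiableWithinAt
    · rw [interior_Ici] at hs
      rw [((hd s (le_of_lt hs)).hasDerivAt (Ici_mem_nhds hs)).deriv, real_inner_comm]
      nlinarith [hM (u s), Real.exp_pos (2 * γ * s)]
  have h1 := hanti (mem_Ici.2 le_rfl) (mem_Ici.2 ht) ht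
  simp only [hf, mul_zero, Real.exp_zero, one_mul] at h1
  refine le_of_sq_le_sq ?_ (by positivity)
  calc ‖u t‖ ^ 2 = Real.exp (-γ * t) ^ 2 * (Real.exp (2 * γ * t) * ‖u t‖ ^ 2) := by
        rw [← mul_assoc, sq (Real.exp _), ← Real.exp_add, ← Real.exp_add]
        ring_nf
        simp
    _ ≤ Real.exp (-γ * t) ^ 2 * ‖u 0‖ ^ 2 := by gcongr
    _ = _ := by ring

/-- The affine equation `M x + b = 0` is uniquely solvable if `M + γ` is dissipative, `γ > 0`. -/
lemma exists_forall_add_eq_zero_iff_of_dissipative [CompleteSpace H] {γ : ℝ} (hγ : 0 < γ)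
    {M : H →L[ℝ] H} (hM : ∀ h, ⟪M h, h⟫_ℝ ≤ -γ * ‖h‖ ^ 2) (b : H) :
    ∃ w, ∀ x, M x + b = 0 ↔ x = w := by
  -- Dissipativity is coercivity of `-M`, so Lax–Milgram makes `-M` invertible.
  have hco : IsCoercive ((innerSL ℝ).comp (-M) : H →L[ℝ] H →L[ℝ] ℝ) :=
    ⟨γ, hγ, fun u => by
      simp only [ContinuousLinearMap.comp_apply, FunLike.coe_neg, Pi.neg_apply,
        innerSL_apply_apply, inner_neg_left]
      nlinarith [hM u]⟩
  have heq : ∀ x, hco.continuousLinearEquivOfBilin x = -M x := fun x =>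
    ext_inner_right ℝ fun y => by
      rw [hco.continuousLinearEquivOfBilin_apply]
      simp
  refine ⟨hco.continuousLinearEquivOfBilin.symm b, fun x => ?_⟩
  rw [ContinuousLinearEquiv.eq_symm_apply, heq, neg_eq_iff_add_eq_zero]

/-- Relative to the equilibrium `w` the equation is homogeneous, so the operator exponential solves
it. -/
lemma exists_hasDerivAt_affine [CompleteSpace H] (M : H →L[ℝ] H) {b w : H} (hw : M w + b = 0)
    (x₀ : H) : ∃ u : ℝ → H, u 0 = x₀ ∧ ∀ t, HasDerivAt u (M (u t) + b) t := by
  refine ⟨fun t => w + NormedSpace.exp (t • M) (x₀ - w), by simp, fun t => ?_⟩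
  have h1 := ((hasDerivAt_exp_smul_const' (𝕂 := ℝ) M t).clm_apply
    (hasDerivAt_const t (x₀ - w))).const_add w
  convert! h1 using 1
  rw [map_add, map_zero, add_zero, add_right_comm, hw, zero_add]
  rfl

end Hilbert

/-! ### Markov kernels as contractions of `L²(μ)`. -/

section KernelL2

open scoped InnerProductSpace

lemma real_inner_eq_mul (a b : ℝ) : ⟪a, b⟫_ℝ = a * b := by simp [mul_comm]

variable {α : Type*} [MeasurableSpace α] {κ η : Kernel α α} {μ : Measure α}

namespace ProbabilityTheory.Kernel.Invariant

/-- A `μ`-null set is also null for `κ x`, for almost every `x`. This lets integration against `κ`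
act on `L²` classes. -/
lemma ae_ae (hκ : κ.Invariant μ) {p : α → Prop} (hp : ∀ᵐ x ∂μ, p x) :
    ∀ᵐ x ∂μ, ∀ᵐ y ∂κ x, p y :=
  Measure.ae_ae_of_ae_comp (by rwa [hκ.def])

lemma integral_eq (hκ : κ.Invariant μ) {f : α → ℝ} (hf : Integrable f μ) :
    ∫ x, ∫ y, f y ∂κ x ∂μ = ∫ x, f x ∂μ := by
  have h := Kernel.integral_comp (κ := Kernel.const Unit μ) (η := κ) (a := ()) (f := f)
    (by rwa [← Measure.comp_eq_comp_const_apply, hκ.def])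
  rw [← Measure.comp_eq_comp_const_apply, hκ.def] at h
  exact h.symm

lemma integral_ae_eq_of_ae_eq (hκ : κ.Invariant μ) {f g : α → ℝ} (h : f =ᵐ[μ] g) :
    (fun x => ∫ y, f y ∂κ x) =ᵐ[μ] fun x => ∫ y, g y ∂κ x := by
  filter_upwards [hκ.ae_ae h] with x hx using integral_congr_ae hx

lemma ae_memLp_two (hκ : κ.Invariant μ) {f : α → ℝ} (hf : MemLp f 2 μ) :
    ∀ᵐ x ∂μ, MemLp f 2 (κ x) := by
  have hsq : Integrable (fun x => f x ^ 2) (μ.bind κ) := by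
    rw [hκ.def]; exact hf.integrable_sq
  filter_upwards [((Measure.integrable_comp_iff hsq.1).1 hsq).1, hκ.ae_ae hf.1.ae_eq_mk]
    with x hx hx'
  exact (memLp_two_iff_integrable_sq ⟨_, hf.1.stronglyMeasurable_mk, hx'⟩).2 hx

lemma integrable_integral_sq (hκ : κ.Invariant μ) {f : α → ℝ} (hf : MemLp f 2 μ) :
    Integrable (fun x => ∫ y, f y ^ 2 ∂κ x) μ := by
  have hsq : Integrable (fun x => f x ^ 2) (μ.bind κ) := by
    rw [hκ.def]; exact hf.integrable_sq
  have := ((Measure.integrable_comp_iff hsq.1).1 hsq).2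
  simpa using this

variable [IsMarkovKernel κ]

/-- Jensen's inequality for the square, in the form of nonnegative variance under `κ x`. -/
lemma ae_sq_integral_le (hκ : κ.Invariant μ) {f : α → ℝ} (hf : MemLp f 2 μ) :
    ∀ᵐ x ∂μ, (∫ y, f y ∂κ x) ^ 2 ≤ ∫ y, f y ^ 2 ∂κ x := by
  filter_upwards [hκ.ae_memLp_two hf] with x hx
  have h1 := variance_nonneg f (κ x)
  rw [variance_eq_sub hx] at h1
  simpa using h1

lemma memLp_integral (hκ : κ.Invariant μ) {f : α → ℝ} (hf : MemLp f 2 μ) :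
    MemLp (fun x => ∫ y, f y ∂κ x) 2 μ := by
  have hm : AEStronglyMeasurable (fun x => ∫ y, f y ∂κ x) μ :=
    ⟨fun x => ∫ y, hf.1.mk f y ∂κ x, hf.1.stronglyMeasurable_mk.integral_kernel,
      hκ.integral_ae_eq_of_ae_eq hf.1.ae_eq_mk⟩
  rw [memLp_two_iff_integrable_sq hm]
  refine (hκ.integrable_integral_sq hf).mono' (hm.pow 2) ?_
  filter_upwards [hκ.ae_sq_integral_le hf] with x hx
  rwa [Real.norm_of_nonneg (sq_nonneg _)]

lemma integral_sq_integral_le (hκ : κ.Invariant μ) {f : α → ℝ} (hf : MemLp f 2 μ) :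
    ∫ x, (∫ y, f y ∂κ x) ^ 2 ∂μ ≤ ∫ x, f x ^ 2 ∂μ := by
  rw [← hκ.integral_eq hf.integrable_sq]
  exact integral_mono_ae (hκ.memLp_integral hf).integrable_sq (hκ.integrable_integral_sq hf)
    (hκ.ae_sq_integral_le hf)

end ProbabilityTheory.Kernel.Invariant

lemma MeasureTheory.MemLp.norm_toLp_sq {f : α → ℝ} (hf : MemLp f 2 μ) :
    ‖hf.toLp f‖ ^ 2 = ∫ x, f x ^ 2 ∂μ := by
  rw [← real_inner_self_eq_norm_sq, L2.inner_def]
  refine integral_congr_ae ?_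
  filter_upwards [hf.coeFn_toLp] with x hx
  simp [hx, sq]

lemma l2norm_eq_norm {f : α → ℝ} {u : Lp ℝ 2 μ} (h : f =ᵐ[μ] u) : l2norm μ f = ‖u‖ := by
  rw [l2norm, Real.sqrt_eq_iff_eq_sq (integral_nonneg fun x => sq_nonneg _) (norm_nonneg _),
    ← real_inner_self_eq_norm_sq, L2.inner_def]
  refine integral_congr_ae ?_
  filter_upwards [h] with x hx
  simp [hx, sq]

/-- The contraction of `L²(μ)` given by a Markov kernel with invariant measure `μ`. -/
noncomputable def kernelL2 (κ : Kernel α α) [IsMarkovKernel κ] (hκ : κ.Invariant μ) :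
    Lp ℝ 2 μ →L[ℝ] Lp ℝ 2 μ :=
  LinearMap.mkContinuous
    { toFun := fun f => (hκ.memLp_integral (Lp.memLp f)).toLp _
      map_add' := fun f g => by
        rw [← MemLp.toLp_add, MemLp.toLp_eq_toLp_iff]
        filter_upwards [hκ.ae_ae (Lp.coeFn_add f g), hκ.ae_memLp_two (Lp.memLp f),
          hκ.ae_memLp_two (Lp.memLp g)] with x hx hf hg
        simp only [Pi.add_apply]
        rw [integral_congr_ae hx]
        exact integral_add (hf.integrable (by norm_num)) (hg.integrable (by norm_num))
      map_smul' := fun c f => by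
        rw [RingHom.id_apply, ← MemLp.toLp_const_smul, MemLp.toLp_eq_toLp_iff]
        filter_upwards [hκ.ae_ae (Lp.coeFn_smul c f)] with x hx
        rw [integral_congr_ae hx]
        exact integral_const_mul c _ } 1 fun f => by
    rw [one_mul]
    refine le_of_sq_le_sq ?_ (norm_nonneg _)
    have h := hκ.integral_sq_integral_le (Lp.memLp f)
    rwa [← (Lp.memLp f).norm_toLp_sq, Lp.toLp_coeFn,
      ← (hκ.memLp_integral (Lp.memLp f)).norm_toLp_sq] at h

section
variable [IsMarkovKernel κ] [IsMarkovKernel η]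

lemma norm_kernelL2_apply_le (hκ : κ.Invariant μ) (f : Lp ℝ 2 μ) : ‖kernelL2 κ hκ f‖ ≤ ‖f‖ := by
  simpa using (kernelL2 κ hκ).le_of_opNorm_le (LinearMap.mkContinuous_norm_le _ zero_le_one _) f

lemma kernelL2_ae_eq (hκ : κ.Invariant μ) {f : α → ℝ} {u : Lp ℝ 2 μ} (h : f =ᵐ[μ] u) :
    kernelL2 κ hκ u =ᵐ[μ] fun x => ∫ y, f y ∂κ x :=
  (MemLp.coeFn_toLp (hκ.memLp_integral (Lp.memLp u))).trans (hκ.integral_ae_eq_of_ae_eq h.symm)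

/-- Kernels act on functions contravariantly, which reverses the order of the factors. -/
lemma kernelL2_of_eq_comp {ξ : Kernel α α} [IsMarkovKernel ξ] (hκ : κ.Invariant μ)
    (hη : η.Invariant μ) (hξ : ξ.Invariant μ) (h : ξ = κ ∘ₖ η) :
    kernelL2 ξ hξ = kernelL2 η hη * kernelL2 κ hκ := by
  subst h
  ext1 f
  refine Lp.ext ?_
  refine (kernelL2_ae_eq hξ (EventuallyEq.refl _ (f : α → ℝ))).trans ?_
  refine EventuallyEq.trans ?_ (kernelL2_ae_eq hη
    (kernelL2_ae_eq hκ (EventuallyEq.refl _ (f : α → ℝ))).symm).symm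
  filter_upwards [hξ.ae_memLp_two (Lp.memLp f)] with x hx
  exact Kernel.integral_comp (hx.integrable (by norm_num))

end

end KernelL2

/-! ### The transition semigroup and joint measurability of the paths. -/

namespace StrongMarkovProcess

open scoped InnerProductSpace

variable {E Ω : Type*} [TopologicalSpace E] [MeasurableSpace E] [MeasurableSpace Ω]
  (X : StrongMarkovProcess E Ω)

instance : IsMarkovKernel X.law := X.isMarkovKernel_law

lemma measurable_path (t : ℝ≥0) : Measurable (X.path t) :=
  (X.adapted t).mono (X.filtration.le t) le_rfl

/-- The transition kernel at time `t` (at time `0` if `t < 0`). -/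
noncomputable def transition (t : ℝ) : Kernel E E := X.law.map (X.path t.toNNReal)

instance (t : ℝ) : IsMarkovKernel (X.transition t) :=
  Kernel.IsMarkovKernel.map _ (X.measurable_path _)

lemma transition_apply (t : ℝ) (x : E) {B : Set E} (hB : MeasurableSet B) :
    X.transition t x B = X.law x {ω | X.path t.toNNReal ω ∈ B} := by
  rw [transition, Kernel.map_apply' _ (X.measurable_path _) _ hB]
  rfl

lemma transition_add {s t : ℝ} (hs : 0 ≤ s) (ht : 0 ≤ t) :
    X.transition (s + t) = X.transition t ∘ₖ X.transition s := by
  ext x B hB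
  -- Chapman–Kolmogorov is the strong Markov property at the constant time `s`, with `F` the whole
  -- space.
  have h := X.strongMarkov x (fun _ => (s.toNNReal : WithTop ℝ≥0)) (isStoppingTime_const _ _)
    t.toNNReal univ B MeasurableSet.univ (fun _ _ => WithTop.coe_ne_top) hB
  rw [X.transition_apply _ _ hB, Kernel.comp_apply' _ _ _ hB, transition, transition,
    Kernel.lintegral_map _ (X.measurable_path _) _ (Kernel.measurable_coe _ hB),
    Real.toNNReal_add hs ht]
  simp only [univ_inter, WithTop.untopD_coe, Measure.restrict_univ] at h
  rw [h]
  refine lintegral_congr fun ω => ?_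
  rw [Kernel.map_apply' _ (X.measurable_path _) _ hB]
  rfl

lemma transition_zero : X.transition 0 = Kernel.id := by
  ext x B hB
  rw [X.transition_apply _ _ hB, Kernel.id_apply, Measure.dirac_apply' _ hB, Real.toNNReal_zero]
  have h : X.law x {ω | X.path 0 ω ∈ B} = X.law x {_ω | x ∈ B} := by
    refine measure_congr ?_
    filter_upwards [X.initial x] with ω hω
    change (X.path 0 ω ∈ B) = (x ∈ B)
    rw [hω]
  rw [h]
  by_cases hx : x ∈ B <;> simp [hx]

section L2

variable {X} {μ : Measure E} (hμ : X.IsStationary μ)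

include hμ in
lemma invariant_transition (t : ℝ) : (X.transition t).Invariant μ := hμ t.toNNReal

/-- The Markov semigroup on `L²(μ)`. -/
noncomputable def semigroupL2 (t : ℝ) : Lp ℝ 2 μ →L[ℝ] Lp ℝ 2 μ :=
  kernelL2 (X.transition t) (invariant_transition hμ t)

lemma isDecayingSemigroup_semigroupL2 : IsDecayingSemigroup 0 (semigroupL2 hμ) where
  zero := by
    ext1 f
    refine Lp.ext ((kernelL2_ae_eq _ (EventuallyEq.refl _ (f : E → ℝ))).trans ?_)
    rw [transition_zero]
    refine Eventually.of_forall fun x => ?_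
    simp only [Kernel.id_apply]
    exact integral_dirac' _ _ (Lp.stronglyMeasurable f)
  add s t hs ht := kernelL2_of_eq_comp _ _ _ (X.transition_add hs ht)
  norm_le t _ f := by
    rw [neg_zero, zero_mul, Real.exp_zero, one_mul]
    exact norm_kernelL2_apply_le (invariant_transition hμ t) f

lemma semigroup_ae_eq {f : E → ℝ} {u : Lp ℝ 2 μ} (h : f =ᵐ[μ] u) (t : ℝ) :
    X.semigroup t.toNNReal f =ᵐ[μ] semigroupL2 hμ t u := by
  have hinv := invariant_transition hμ t
  refine EventuallyEq.trans ?_ (kernelL2_ae_eq hinv h).symm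
  have hf : MemLp f 2 μ := (memLp_congr_ae h).2 (Lp.memLp u)
  filter_upwards [hinv.ae_memLp_two hf] with x hx
  have h1 := hx.1
  rw [transition, Kernel.map_apply _ (X.measurable_path _)] at h1 ⊢
  rw [integral_map (X.measurable_path _).aemeasurable h1, semigroup]

lemma HasGenerator.tendsto_slope {f : E → ℝ} {g : Lp ℝ 2 μ} (h : X.HasGenerator μ f g) :
    Tendsto (fun t : ℝ => t⁻¹ • (semigroupL2 hμ t (h.1.toLp f) - h.1.toLp f)) (𝓝[>] 0) (𝓝 g) := by
  have hnn : Tendsto Real.toNNReal (𝓝[>] 0) (𝓝[>] 0) := by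
    refine tendsto_nhdsWithin_iff.2 ⟨?_, ?_⟩
    · simpa using (continuous_real_toNNReal.tendsto 0).mono_left nhdsWithin_le_nhds
    · filter_upwards [self_mem_nhdsWithin] with t ht using Real.toNNReal_pos.2 ht
  rw [tendsto_iff_edist_tendsto_0]
  refine (h.2.comp hnn).congr' ?_
  filter_upwards [self_mem_nhdsWithin] with t ht
  rw [Lp.edist_def]
  refine eLpNorm_congr_ae ?_
  have hf := h.1.coeFn_toLp
  filter_upwards [hf, semigroup_ae_eq hμ hf.symm t,
    Lp.coeFn_smul t⁻¹ (semigroupL2 hμ t (h.1.toLp f) - h.1.toLp f),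
    Lp.coeFn_sub (semigroupL2 hμ t (h.1.toLp f)) (h.1.toLp f)] with x h1 h2 h3 h4
  simp only [Pi.sub_apply, h3, Pi.smul_apply, h4, h1, ← h2, smul_eq_mul,
    Real.coe_toNNReal t (le_of_lt ht)]
  ring

end L2

section Resolvent

variable [T2Space E] [LocallyCompactSpace E] [SecondCountableTopology E] [BorelSpace E]

lemma tendsto_nnreal_floor_div (t : ℝ≥0) :
    Tendsto (fun n : ℕ => ((⌊t * (n + 1)⌋₊ : ℝ≥0) + 1) / (n + 1)) atTop (𝓝[≥] t) := by
  have hlt : ∀ n : ℕ, t ≤ ((⌊t * (n + 1)⌋₊ : ℝ≥0) + 1) / (n + 1) := fun n => by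
    rw [le_div_iff₀ (by positivity)]
    exact (Nat.lt_floor_add_one _).le
  have hle : ∀ n : ℕ, ((⌊t * (n + 1)⌋₊ : ℝ≥0) + 1) / (n + 1) ≤ t + 1 / (n + 1) := fun n => by
    rw [div_le_iff₀ (by positivity), add_mul, one_div, inv_mul_cancel₀ (by positivity)]
    gcongr
    exact Nat.floor_le (by positivity)
  refine tendsto_nhdsWithin_iff.2 ⟨?_, Eventually.of_forall hlt⟩
  refine tendsto_of_tendsto_of_tendsto_of_le_of_le tendsto_const_nhds ?_ hlt hle
  simpa using (tendsto_one_div_add_atTop_nhds_zero_nat (𝕜 := ℝ≥0)).const_add t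

omit [T2Space E] [LocallyCompactSpace E] [SecondCountableTopology E] [BorelSpace E] in
lemma measurable_path_comp_countable (c : ℕ → ℝ≥0) {k : ℝ≥0 → ℕ} (hk : Measurable k) :
    Measurable fun p : Ω × ℝ≥0 => X.path (c (k p.2)) p.1 := by
  have h1 : Measurable fun q : Ω × ℕ => X.path (c q.2) q.1 :=
    measurable_from_prod_countable_left fun m => X.measurable_path (c m)
  exact h1.comp (measurable_fst.prodMk (hk.comp measurable_snd))

/-- Rounding time up to a grid of mesh `1 / (n + 1)` leaves countably many times, hence a jointly
measurable process. Right continuity gives the path as the limit, since the rounded times approach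
`t` from the right. -/
lemma measurable_uncurry_path : Measurable fun p : Ω × ℝ≥0 => X.path p.2 p.1 := by
  have : TopologicalSpace.MetrizableSpace E :=
    TopologicalSpace.metrizableSpace_of_t3_secondCountable E
  let c : ℕ → ℕ → ℝ≥0 := fun n m => ((m : ℝ≥0) + 1) / (n + 1)
  let k : ℕ → ℝ≥0 → ℕ := fun n t => ⌊t * (n + 1)⌋₊
  have hk : ∀ n, Measurable (k n) := fun n => Nat.measurable_floor.comp (measurable_id.mul_const _)
  have hlim : ∀ t, Tendsto (fun n => c n (k n t)) atTop (𝓝[≥] t) := tendsto_nnreal_floor_div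
  clear_value c k
  exact measurable_of_tendsto_metrizable (fun n => X.measurable_path_comp_countable (c n) (hk n))
    (tendsto_pi_nhds.2 fun p => (X.cadlag p.1 p.2).1.tendsto.comp (hlim p.2))

lemma measurable_path_toNNReal : Measurable fun p : Ω × ℝ => X.path p.2.toNNReal p.1 :=
  X.measurable_uncurry_path.comp
    (measurable_fst.prodMk (measurable_real_toNNReal.comp measurable_snd))

end Resolvent

end StrongMarkovProcess

/-! ### Exponential time, the resolvent kernel and the value function. -/

section ExpTime

/-- The exponential distribution with rate `γ`, as a measure with density on `(0, ∞)`. -/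
noncomputable def expTime (γ : ℝ) : Measure ℝ :=
  (volume.restrict (Ioi 0)).withDensity fun t => ENNReal.ofReal (γ * Real.exp (-γ * t))

variable {γ : ℝ}

lemma measurable_expTime_density (γ : ℝ) :
    Measurable fun t : ℝ => ENNReal.ofReal (γ * Real.exp (-γ * t)) := by fun_prop

lemma isProbabilityMeasure_expTime (hγ : 0 < γ) : IsProbabilityMeasure (expTime γ) where
  measure_univ := by
    rw [expTime, withDensity_apply _ MeasurableSet.univ, Measure.restrict_univ,
      ← ofReal_integral_eq_lintegral_ofReal
        ((integrableOn_exp_mul_Ioi (neg_neg_of_pos hγ) 0).const_mul γ)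
        (Eventually.of_forall fun t => by positivity),
      integral_const_mul, integral_exp_mul_Ioi (neg_neg_of_pos hγ)]
    simp [hγ.ne']

lemma integral_expTime (hγ : 0 < γ) (f : ℝ → ℝ) :
    ∫ t, f t ∂expTime γ = γ * ∫ t in Ioi 0, Real.exp (-γ * t) * f t := by
  rw [expTime, integral_withDensity_eq_integral_toReal_smul (measurable_expTime_density γ)
    (by simp), ← integral_const_mul]
  refine integral_congr_ae (Eventually.of_forall fun t => ?_)
  simp only [smul_eq_mul]
  rw [ENNReal.toReal_ofReal (by positivity), mul_assoc]

lemma integrable_expTime_iff (hγ : 0 < γ) {f : ℝ → ℝ} :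
    Integrable f (expTime γ) ↔ IntegrableOn (fun t => Real.exp (-γ * t) * f t) (Ioi 0) := by
  rw [expTime, integrable_withDensity_iff_integrable_smul' (measurable_expTime_density γ)
    (by simp), IntegrableOn]
  rw [← integrable_const_mul_iff (isUnit_iff_ne_zero.2 hγ.ne')
    (fun t => Real.exp (-γ * t) * f t)]
  refine integrable_congr (Eventually.of_forall fun t => ?_)
  simp only [smul_eq_mul]
  rw [ENNReal.toReal_ofReal (by positivity), mul_assoc]

lemma integrable_prod_expTime_iff {Ω : Type*} [MeasurableSpace Ω] {P : Measure Ω} [SFinite P]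
    (hγ : 0 < γ) {f : Ω × ℝ → ℝ} :
    Integrable f (P.prod (expTime γ)) ↔
      Integrable (fun p => Real.exp (-γ * p.2) * f p) (P.prod (volume.restrict (Ioi 0))) := by
  have hm : Measurable fun p : Ω × ℝ => ENNReal.ofReal (γ * Real.exp (-γ * p.2)) := by fun_prop
  rw [expTime, prod_withDensity_right (measurable_expTime_density γ),
    integrable_withDensity_iff_integrable_smul' hm (by simp)]
  rw [← integrable_const_mul_iff (isUnit_iff_ne_zero.2 hγ.ne')
    (fun p : Ω × ℝ => Real.exp (-γ * p.2) * f p)]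
  refine integrable_congr (Eventually.of_forall fun t => ?_)
  simp only [smul_eq_mul]
  rw [ENNReal.toReal_ofReal (by positivity), mul_assoc]

end ExpTime

namespace StrongMarkovProcess

open scoped InnerProductSpace

variable {E Ω : Type*} [TopologicalSpace E] [MeasurableSpace E] [MeasurableSpace Ω]
  [T2Space E] [LocallyCompactSpace E] [SecondCountableTopology E] [BorelSpace E]
  (X : StrongMarkovProcess E Ω) {γ : ℝ}

/-- The law of the process at an independent exponential time: `γ` times the resolvent. -/
noncomputable def resolventKernel (γ : ℝ) : Kernel E E :=
  (X.law ×ₖ Kernel.const E (expTime γ)).map fun p => X.path p.2.toNNReal p.1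

lemma isMarkovKernel_resolventKernel (hγ : 0 < γ) : IsMarkovKernel (X.resolventKernel γ) := by
  have := isProbabilityMeasure_expTime hγ
  exact Kernel.IsMarkovKernel.map _ X.measurable_path_toNNReal

lemma resolventKernel_eq_map (hγ : 0 < γ) (x : E) : X.resolventKernel γ x =
    ((X.law x).prod (expTime γ)).map fun p => X.path p.2.toNNReal p.1 := by
  have := isProbabilityMeasure_expTime hγ
  rw [resolventKernel, Kernel.map_apply _ X.measurable_path_toNNReal, Kernel.prod_apply,
    Kernel.const_apply]

variable {X} {μ : Measure E} [IsProbabilityMeasure μ] (hμ : X.IsStationary μ)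
include hμ

/-- The resolvent kernel is a mixture over `t` of transition kernels, each of which preserves `μ`.
-/
lemma invariant_resolventKernel (hγ : 0 < γ) : (X.resolventKernel γ).Invariant μ := by
  have := isProbabilityMeasure_expTime hγ
  ext B hB
  rw [Measure.bind_apply hB (Kernel.aemeasurable _)]
  have hS := X.measurable_path_toNNReal hB
  have h1 : ∀ x, X.resolventKernel γ x B = ∫⁻ t, X.transition t x B ∂expTime γ := fun x => by
    rw [X.resolventKernel_eq_map hγ, Measure.map_apply X.measurable_path_toNNReal hB,
      Measure.prod_apply_symm hS]
    exact lintegral_congr fun t => (X.transition_apply t x hB).symm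
  have hS' : MeasurableSet {p : (E × ℝ) × Ω | X.path p.1.2.toNNReal p.2 ∈ B} :=
    (X.measurable_path_toNNReal.comp
      (measurable_snd.prodMk (measurable_snd.comp measurable_fst))) hB
  have h2 : Measurable fun p : E × ℝ => X.transition p.2 p.1 B := by
    simp only [X.transition_apply _ _ hB]
    exact Kernel.measurable_kernel_prodMk_left (κ := Kernel.prodMkRight ℝ X.law) hS'
  simp_rw [h1]
  rw [lintegral_lintegral_swap h2.aemeasurable]
  have h3 : ∀ t, ∫⁻ x, X.transition t x B ∂μ = μ B := fun t => by
    rw [← Measure.bind_apply hB (Kernel.aemeasurable _), (invariant_transition hμ t).def]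
  simp [h3]

lemma ae_integrable_path (hγ : 0 < γ) {f : E → ℝ} (hf : MemLp f 2 μ) :
    ∀ᵐ x ∂μ, Integrable (fun p : Ω × ℝ => f (X.path p.2.toNNReal p.1))
      ((X.law x).prod (expTime γ)) := by
  have := X.isMarkovKernel_resolventKernel hγ
  filter_upwards [(invariant_resolventKernel hμ hγ).ae_memLp_two hf] with x hx
  have h := hx.integrable (by norm_num)
  rw [X.resolventKernel_eq_map hγ] at h
  exact h.comp_measurable X.measurable_path_toNNReal

lemma ae_integral_resolventKernel (hγ : 0 < γ) {f : E → ℝ} (hf : MemLp f 2 μ) :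
    ∀ᵐ x ∂μ, ∫ y, f y ∂X.resolventKernel γ x =
      ∫ p, f (X.path p.2.toNNReal p.1) ∂((X.law x).prod (expTime γ)) := by
  have := X.isMarkovKernel_resolventKernel hγ
  filter_upwards [(invariant_resolventKernel hμ hγ).ae_memLp_two hf] with x hx
  have h := hx.1
  rw [X.resolventKernel_eq_map hγ] at h ⊢
  exact integral_map X.measurable_path_toNNReal.aemeasurable h

/-- This transfers the `L²` theory of invariant Markov kernels to `V*`. The factor `γ⁻¹` undoes the
normalization of the exponential law. -/
lemma valueFunction_ae_eq (hγ : 0 < γ) {r : E → ℝ} (hr : MemLp r 2 μ) :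
    X.valueFunction γ r =ᵐ[μ] fun x => γ⁻¹ * ∫ y, r y ∂X.resolventKernel γ x := by
  have := isProbabilityMeasure_expTime hγ
  filter_upwards [ae_integrable_path hμ hγ hr, ae_integral_resolventKernel hμ hγ hr] with x h1 h2
  rw [h2, integral_prod _ h1, valueFunction, ← integral_const_mul]
  refine integral_congr_ae (Eventually.of_forall fun ω => ?_)
  simp only
  rw [integral_expTime hγ, inv_mul_cancel_left₀ hγ.ne']

lemma ae_integrable_discounted (hγ : 0 < γ) {r : E → ℝ} (hr : MemLp r 2 μ) :
    ∀ᵐ x ∂μ, Integrable (fun p : Ω × ℝ => Real.exp (-γ * p.2) * r (X.path p.2.toNNReal p.1))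
      ((X.law x).prod (volume.restrict (Ioi 0))) := by
  filter_upwards [ae_integrable_path hμ hγ hr] with x hx
  exact (integrable_prod_expTime_iff hγ).1 hx

lemma memLp_valueFunction (hγ : 0 < γ) {r : E → ℝ} (hr : MemLp r 2 μ) :
    MemLp (X.valueFunction γ r) 2 μ := by
  have := X.isMarkovKernel_resolventKernel hγ
  exact (memLp_congr_ae (valueFunction_ae_eq hμ hγ hr)).2
    (((invariant_resolventKernel hμ hγ).memLp_integral hr).const_mul _)

/-- Weak form of `V* = ∫₀^∞ e^{-γ t} P_t r dt`. -/
lemma inner_valueFunction (hγ : 0 < γ) {r : E → ℝ} (hr : MemLp r 2 μ) (g : Lp ℝ 2 μ) :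
    IntegrableOn (fun t => ⟪g, (Real.exp (-γ * t) • semigroupL2 hμ t) (hr.toLp r)⟫_ℝ) (Ioi 0) ∧
    ⟪g, (memLp_valueFunction hμ hγ hr).toLp (X.valueFunction γ r)⟫_ℝ =
      ∫ t in Ioi 0, ⟪g, (Real.exp (-γ * t) • semigroupL2 hμ t) (hr.toLp r)⟫_ℝ := by
  have := isProbabilityMeasure_expTime hγ
  have := X.isMarkovKernel_resolventKernel hγ
  set u := hr.toLp r with hu
  have hru : r =ᵐ[μ] u := hr.coeFn_toLp.symm
  have hum : StronglyMeasurable u := Lp.stronglyMeasurable u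
  -- A jointly measurable version of `(x, t) ↦ P_t u x`, as Fubini requires.
  let F : E × ℝ → ℝ := fun p => ∫ ω, u (X.path p.2.toNNReal ω) ∂X.law p.1
  have hFm : StronglyMeasurable F := by
    have h1 : StronglyMeasurable fun q : (E × ℝ) × Ω => u (X.path q.1.2.toNNReal q.2) :=
      hum.comp_measurable (X.measurable_path_toNNReal.comp
        (measurable_snd.prodMk (measurable_snd.comp measurable_fst)))
    exact StronglyMeasurable.integral_kernel_prod_right' (κ := Kernel.prodMkRight ℝ X.law) h1
  have hFtr : ∀ t, (fun x => F (x, t)) = fun x => ∫ y, u y ∂X.transition t x := fun t => by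
    ext x
    rw [transition, Kernel.map_apply _ (X.measurable_path _),
      integral_map (X.measurable_path _).aemeasurable hum.aestronglyMeasurable]
  have hFt : ∀ t, semigroupL2 hμ t u =ᵐ[μ] fun x => F (x, t) := fun t => by
    rw [hFtr]
    exact kernelL2_ae_eq (invariant_transition hμ t) (EventuallyEq.refl _ (u : E → ℝ))
  have hgm : StronglyMeasurable g := Lp.stronglyMeasurable g
  have hFLp : ∀ t, MemLp (fun x => F (x, t)) 2 μ := fun t => by
    rw [hFtr]; exact (invariant_transition hμ t).memLp_integral (Lp.memLp u)
  have hGm : StronglyMeasurable fun p : E × ℝ => g p.1 * F p :=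
    (hgm.comp_measurable measurable_fst).mul hFm
  have hGint : Integrable (fun p : E × ℝ => g p.1 * F p) (μ.prod (expTime γ)) := by
    rw [integrable_prod_iff' hGm.aestronglyMeasurable]
    refine ⟨Eventually.of_forall fun t => (Lp.memLp g).integrable_mul (hFLp t), ?_⟩
    -- From `|g F| ≤ g² + F²` and contractivity of `P_t`, this bound does not depend on `t`.
    refine Integrable.of_bound (hGm.norm.integral_prod_left').aestronglyMeasurable
      ((∫ x, g x ^ 2 ∂μ) + ∫ x, u x ^ 2 ∂μ) (Eventually.of_forall fun t => ?_)
    rw [Real.norm_of_nonneg (integral_nonneg fun x => norm_nonneg _)]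
    calc ∫ x, ‖g x * F (x, t)‖ ∂μ ≤ ∫ x, (g x ^ 2 + F (x, t) ^ 2) ∂μ := by
          refine integral_mono ((Lp.memLp g).integrable_mul (hFLp t)).norm
            ((Lp.memLp g).integrable_sq.add (hFLp t).integrable_sq) fun x => ?_
          simp only [norm_mul, Real.norm_eq_abs]
          nlinarith [sq_nonneg (|g x| - |F (x, t)|), sq_abs (g x), sq_abs (F (x, t)),
            sq_nonneg (g x), sq_nonneg (F (x, t))]
      _ = (∫ x, g x ^ 2 ∂μ) + ∫ x, F (x, t) ^ 2 ∂μ :=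
          integral_add (Lp.memLp g).integrable_sq (hFLp t).integrable_sq
      _ ≤ _ := by
          have h := (invariant_transition hμ t).integral_sq_integral_le (Lp.memLp u)
          simp only [← congrFun (hFtr t)] at h
          exact add_le_add_right h _
  have hinner : ∀ t, ∫ x, g x * F (x, t) ∂μ = ⟪g, semigroupL2 hμ t u⟫_ℝ := fun t => by
    rw [L2.inner_def]
    refine integral_congr_ae ?_
    filter_upwards [hFt t] with x hx
    simp [hx, mul_comm]
  have hsm : ∀ t, ⟪g, (Real.exp (-γ * t) • semigroupL2 hμ t) u⟫_ℝ =
      Real.exp (-γ * t) * ∫ x, g x * F (x, t) ∂μ := fun t => by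
    rw [hinner, FunLike.coe_smul, Pi.smul_apply, real_inner_smul_right]
  simp_rw [hsm]
  refine ⟨(integrable_expTime_iff hγ).1 hGint.integral_prod_right, ?_⟩
  have hV : (memLp_valueFunction hμ hγ hr).toLp (X.valueFunction γ r) =ᵐ[μ]
      fun x => γ⁻¹ * ∫ t, F (x, t) ∂expTime γ := by
    refine (MemLp.coeFn_toLp _).trans ((valueFunction_ae_eq hμ hγ hr).trans ?_)
    filter_upwards [(invariant_resolventKernel hμ hγ).integral_ae_eq_of_ae_eq hru,
      ae_integrable_path hμ hγ (Lp.memLp u), ae_integral_resolventKernel hμ hγ (Lp.memLp u)]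
      with x h1 h2 h3
    rw [h1, h3, integral_prod_symm _ h2]
  calc ⟪g, (memLp_valueFunction hμ hγ hr).toLp (X.valueFunction γ r)⟫_ℝ
      = ∫ x, γ⁻¹ * ∫ t, g x * F (x, t) ∂expTime γ ∂μ := by
        rw [L2.inner_def]
        refine integral_congr_ae ?_
        filter_upwards [hV] with x hx
        rw [hx, integral_const_mul]
        rw [real_inner_eq_mul]
        ring
    _ = γ⁻¹ * ∫ t, ∫ x, g x * F (x, t) ∂μ ∂expTime γ := by
        rw [integral_const_mul, integral_integral_swap hGint]
    _ = _ := by rw [integral_expTime hγ, inv_mul_cancel_left₀ hγ.ne']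

end StrongMarkovProcess

/-! ### The inclusion of `H` into `L²(μ)` and its adjoint. -/

/-- The infinitesimal generator of a family of operators `S t` as `t ↓ 0`, composed with a bounded
operator `j` into its domain; it is bounded by the Banach–Steinhaus theorem. -/
noncomputable def slopeLimitCLM {H L : Type*} [NormedAddCommGroup H] [NormedSpace ℝ H]
    [CompleteSpace H] [NormedAddCommGroup L] [NormedSpace ℝ L] (S : ℝ → L →L[ℝ] L) (j : H →L[ℝ] L)
    (A : H → L) (h : ∀ x, Tendsto (fun t : ℝ => t⁻¹ • (S t (j x) - j x)) (𝓝[>] 0) (𝓝 (A x))) :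
    H →L[ℝ] L :=
  continuousLinearMapOfTendsto (l := 𝓝[>] (0 : ℝ)) (fun t : ℝ => t⁻¹ • ((S t - 1) ∘L j)) (f := A)
    (tendsto_pi_nhds.2 fun x => (h x).congr fun t => by simp)

section RKHS

open scoped InnerProductSpace

variable {E : Type*} [MeasurableSpace E] {μ : Measure E}
  {H : Type*} [NormedAddCommGroup H] [InnerProductSpace ℝ H] [RKHS ℝ H E ℝ]

/-- The inclusion of a Hilbert space of square integrable functions into `L²(μ)`. -/
noncomputable def RKHS.toL2 [CompleteSpace H] (hmem : ∀ h : H, MemLp h 2 μ) : H →L[ℝ] Lp ℝ 2 μ :=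
  let j : H →ₗ[ℝ] Lp ℝ 2 μ :=
    { toFun := fun h => (hmem h).toLp h
      map_add' := fun f g => by
        rw [← MemLp.toLp_add]
        congr 1
        exact RKHS.coe_add f g
      map_smul' := fun c f => by
        rw [RingHom.id_apply, ← MemLp.toLp_const_smul]
        congr 1
        exact RKHS.coe_smul f c }
  { toLinearMap := j
    -- Closed graph: an `L²` limit is an a.e. limit along a subsequence, while convergence in `H` is
    -- pointwise, so the two limits agree.
    cont := j.continuous_of_seq_closed_graph fun u h y hu hy => by
      obtain ⟨ns, hns, hlim⟩ := (tendstoInMeasure_of_tendsto_Lp hy).exists_seq_tendsto_ae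
      refine Lp.ext ?_
      have hall : ∀ᵐ x ∂μ, ∀ n, ((hmem (u n)).toLp (u n)) x = u n x :=
        ae_all_iff.2 fun n => (hmem (u n)).coeFn_toLp
      filter_upwards [hlim, hall, (hmem h).coeFn_toLp] with x h1 h2 h3
      have h4 : Tendsto (fun i => u (ns i) x) atTop (𝓝 (h x)) :=
        ((RKHS.continuous_eval x).tendsto h).comp (hu.comp hns.tendsto_atTop)
      refine (tendsto_nhds_unique h1 (h4.congr fun i => (h2 (ns i)).symm)).trans h3.symm }

variable [CompleteSpace H] (hmem : ∀ h : H, MemLp h 2 μ)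

lemma RKHS.toL2_ae_eq (h : H) : RKHS.toL2 hmem h =ᵐ[μ] h := (hmem h).coeFn_toLp

/-- The adjoint of the inclusion into `L²(μ)` is the integral operator of the kernel. -/
lemma coe_adjoint_toL2_eq_kernelOp {K : E → E → ℝ} (hK : IsKernelOf K H) {V : E → ℝ}
    {u : Lp ℝ 2 μ} (hV : V =ᵐ[μ] u) :
    ⇑((RKHS.toL2 hmem).adjoint u) = kernelOp μ K V := by
  ext x
  -- Evaluating `j* u` at `x` is pairing it with `K(·, x)` in `H`, that is, pairing `u` with `K(·,
  -- x)` in `L²`.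
  have h1 := RKHS.inner_kerFun x (1 : ℝ) ((RKHS.toL2 hmem).adjoint u)
  rw [ContinuousLinearMap.adjoint_inner_left, real_inner_eq_mul, mul_one] at h1
  rw [← h1, L2.inner_def, kernelOp]
  refine integral_congr_ae ?_
  filter_upwards [hV, RKHS.toL2_ae_eq hmem (RKHS.kerFun H x (1 : ℝ))] with z hz hz'
  rw [hz, hz', RKHS.kerFun_apply, hK, real_inner_eq_mul, mul_comm]

variable {hmem} {K : E → E → ℝ} (hK : IsKernelOf K H) (hproj : IsOrthProjOnto μ K H)
include hK hproj

lemma adjoint_toL2_toL2 (h : H) : (RKHS.toL2 hmem).adjoint (RKHS.toL2 hmem h) = h := by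
  refine DFunLike.coe_injective ?_
  rw [coe_adjoint_toL2_eq_kernelOp hmem hK (RKHS.toL2_ae_eq hmem h).symm, hproj.apply_eq]

lemma inner_toL2 (f h : H) : ⟪RKHS.toL2 hmem f, RKHS.toL2 hmem h⟫_ℝ = ⟪f, h⟫_ℝ := by
  rw [← ContinuousLinearMap.adjoint_inner_left, adjoint_toL2_toL2 hK hproj]

lemma norm_toL2 (h : H) : ‖RKHS.toL2 hmem h‖ = ‖h‖ := by
  rw [norm_eq_sqrt_real_inner, inner_toL2 hK hproj, ← norm_eq_sqrt_real_inner]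

end RKHS

/-! ### The generator on `H` and the projected equation as an affine ODE. -/

namespace StrongMarkovProcess

open scoped InnerProductSpace

variable {E Ω : Type*} [TopologicalSpace E] [MeasurableSpace E] [MeasurableSpace Ω]
  {X : StrongMarkovProcess E Ω} {μ : Measure E} (hμ : X.IsStationary μ)
  {H : Type*} [NormedAddCommGroup H] [InnerProductSpace ℝ H] [CompleteSpace H] [RKHS ℝ H E ℝ]

lemma InDomain.hasGenerator {f : E → ℝ} (h : X.InDomain μ f) :
    X.HasGenerator μ f (X.generator μ f) := by
  rw [generator, dif_pos h]
  exact h.choose_spec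

lemma InDomain.memLp {f : E → ℝ} (h : X.InDomain μ f) : MemLp f 2 μ := h.hasGenerator.1

variable (hdom : ∀ f : H, X.InDomain μ f)

/-- The inclusion into `L²(μ)` of a Hilbert space of functions in the domain of the generator. -/
noncomputable abbrev domainToL2 : H →L[ℝ] Lp ℝ 2 μ := RKHS.toL2 fun h => (hdom h).memLp

include hμ in
lemma tendsto_slope_generator (h : H) :
    Tendsto (fun t : ℝ => t⁻¹ • (semigroupL2 hμ t (domainToL2 hdom h) - domainToL2 hdom h))
      (𝓝[>] 0) (𝓝 (X.generator μ h)) :=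
  (hdom h).hasGenerator.tendsto_slope hμ

/-- The generator on a Hilbert space of functions in its domain, bounded by Banach–Steinhaus. -/
noncomputable def generatorCLM : H →L[ℝ] Lp ℝ 2 μ :=
  slopeLimitCLM (semigroupL2 hμ) (domainToL2 hdom) (fun h => X.generator μ h)
    (tendsto_slope_generator hμ hdom)

lemma generatorCLM_apply (h : H) : generatorCLM hμ hdom h = X.generator μ h := rfl

/-- `T f + r` as an element of `L²(μ)`, for `T = A - γ`. -/
noncomputable def bellmanL2 (γ : ℝ) (r : Lp ℝ 2 μ) (f : H) : Lp ℝ 2 μ :=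
  generatorCLM hμ hdom f - γ • domainToL2 hdom f + r

lemma bellman_ae_eq (γ : ℝ) {r : E → ℝ} (hr : MemLp r 2 μ) (f : H) :
    X.bellman μ γ r f =ᵐ[μ] bellmanL2 hμ hdom γ (hr.toLp r) f := by
  filter_upwards [Lp.coeFn_add (generatorCLM hμ hdom f - γ • domainToL2 hdom f) (hr.toLp r),
    Lp.coeFn_sub (generatorCLM hμ hdom f) (γ • domainToL2 hdom f),
    Lp.coeFn_smul γ (domainToL2 hdom f), RKHS.toL2_ae_eq (fun h => (hdom h).memLp) f,
    hr.coeFn_toLp] with x h1 h2 h3 h4 h5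
  rw [bellmanL2, h1, Pi.add_apply, h2, Pi.sub_apply, h3, Pi.smul_apply, h4, h5,
    generatorCLM_apply, bellman, smul_eq_mul]

/-- The linear part `Π A - γ` of the projected evolution equation. -/
noncomputable def projectedCLM (γ : ℝ) : H →L[ℝ] H :=
  (domainToL2 hdom).adjoint ∘L generatorCLM hμ hdom - γ • 1

/-- The adjoint moves `j*` off the generator, leaving `⟪A h, j h⟫ ≤ 0` in `L²(μ)`; projecting does
not destroy dissipativity. -/
lemma inner_projectedCLM_le (γ : ℝ) (h : H) :
    ⟪projectedCLM hμ hdom γ h, h⟫_ℝ ≤ -γ * ‖h‖ ^ 2 := by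
  have h1 := (isDecayingSemigroup_semigroupL2 hμ).inner_slope_nonpos
    (tendsto_slope_generator hμ hdom h)
  have h2 : ⟪projectedCLM hμ hdom γ h, h⟫_ℝ =
      ⟪X.generator μ h, domainToL2 hdom h⟫_ℝ - γ * ‖h‖ ^ 2 := by
    rw [← generatorCLM_apply hμ hdom, ← ContinuousLinearMap.adjoint_inner_left,
      ← real_inner_self_eq_norm_sq, ← real_inner_smul_left, ← inner_sub_left]
    rfl
  linarith

lemma continuous_bellmanL2 (γ : ℝ) (r : Lp ℝ 2 μ) : Continuous (bellmanL2 hμ hdom γ r) := by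
  unfold bellmanL2
  fun_prop

variable {K : E → E → ℝ} (hK : IsKernelOf K H) (hproj : IsOrthProjOnto μ K H)

include hK in
lemma kernelOp_bellman (γ : ℝ) {r : E → ℝ} (hr : MemLp r 2 μ) (f : H) :
    kernelOp μ K (X.bellman μ γ r f) =
      ⇑((domainToL2 hdom).adjoint (bellmanL2 hμ hdom γ (hr.toLp r) f)) :=
  (coe_adjoint_toL2_eq_kernelOp _ hK (bellman_ae_eq hμ hdom γ hr f)).symm

include hK hproj

lemma adjoint_bellmanL2 (γ : ℝ) (r : Lp ℝ 2 μ) (f : H) :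
    (domainToL2 hdom).adjoint (bellmanL2 hμ hdom γ r f) =
      projectedCLM hμ hdom γ f + (domainToL2 hdom).adjoint r := by
  rw [bellmanL2, map_add, map_sub, map_smul, adjoint_toL2_toL2 hK hproj]
  rfl

lemma isProjectedSolution_iff (γ : ℝ) {r : E → ℝ} (hr : MemLp r 2 μ) {V₀ : H} {V : ℝ → H} :
    IsProjectedSolution X μ K γ r V₀ V ↔ V 0 = V₀ ∧ ∀ t, 0 ≤ t →
      HasDerivWithinAt V (projectedCLM hμ hdom γ (V t) +
        (domainToL2 hdom).adjoint (hr.toLp r)) (Ici 0) t := by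
  refine and_congr_right fun _ => forall₂_congr fun t _ => ?_
  rw [← adjoint_bellmanL2 hμ hdom hK hproj, kernelOp_bellman hμ hdom hK γ hr]
  constructor
  · rintro ⟨D, hD, hDe⟩
    rwa [← DFunLike.coe_injective hDe]
  · exact fun h => ⟨_, h, rfl⟩

end StrongMarkovProcess

/-! ### Distance from the projected evolution to the value function. -/

namespace StrongMarkovProcess

variable {E Ω : Type*} [TopologicalSpace E] [T2Space E] [LocallyCompactSpace E]
  [SecondCountableTopology E] [MeasurableSpace E] [BorelSpace E] [MeasurableSpace Ω]
  {X : StrongMarkovProcess E Ω} {μ : Measure E} [IsProbabilityMeasure μ] (hμ : X.IsStationary μ)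
  {H : Type*} [NormedAddCommGroup H] [InnerProductSpace ℝ H] [CompleteSpace H] [RKHS ℝ H E ℝ]
  (hdom : ∀ f : H, X.InDomain μ f) {K : E → E → ℝ} (hK : IsKernelOf K H)
  (hproj : IsOrthProjOnto μ K H)
include hK hproj

lemma norm_sub_valueFunction_le {γ : ℝ} (hγ : 0 < γ) {r : E → ℝ} (hr : MemLp r 2 μ) {V : ℝ → H}
    (hV : ∀ t, 0 ≤ t → HasDerivWithinAt V (projectedCLM hμ hdom γ (V t) +
      (domainToL2 hdom).adjoint (hr.toLp r)) (Ici 0) t) {t M : ℝ} (ht : 0 ≤ t)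
    (hM : ∀ s ∈ Icc 0 t,
      ‖domainToL2 hdom ((domainToL2 hdom).adjoint (bellmanL2 hμ hdom γ (hr.toLp r) (V s))) -
        bellmanL2 hμ hdom γ (hr.toLp r) (V s)‖ ≤ M) :
    ‖domainToL2 hdom (V t) - (memLp_valueFunction hμ hγ hr).toLp (X.valueFunction γ r)‖ ≤
      Real.exp (-γ * t) *
        ‖domainToL2 hdom (V 0) - (memLp_valueFunction hμ hγ hr).toLp (X.valueFunction γ r)‖ +
      (1 - Real.exp (-γ * t)) / γ * M := by
  set j := domainToL2 hdom with hj
  have hjj : ∀ h, j.adjoint (j h) = h := adjoint_toL2_toL2 hK hproj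
  have hder : ∀ s, 0 ≤ s → HasDerivWithinAt (fun s => j (V s))
      (j (j.adjoint (bellmanL2 hμ hdom γ (hr.toLp r) (V s)))) (Ici 0) s := fun s hs => by
    rw [adjoint_bellmanL2 hμ hdom hK hproj]
    exact j.hasFDerivAt.comp_hasDerivWithinAt s (hV s hs)
  -- The perturbation estimate needs an operator on all of `L²(μ)`, so `A` is precomposed with `j*`;
  -- on the range of `j`, where it matters, `j* j = 1` recovers the generator.
  refine ((isDecayingSemigroup_semigroupL2 hμ).exp_smul γ).norm_sub_le_of_perturbed hγ
    (D := range j) (T := fun f => generatorCLM hμ hdom (j.adjoint f) - γ • f)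
    (r := hr.toLp r) (u := fun s => j (V s)) ?_ (fun g => (inner_valueFunction hμ hγ hr g).1)
    (fun g => (inner_valueFunction hμ hγ hr g).2) (fun s _ => mem_range_self _)
    (fun s _ => mem_range_self _) hder ht fun s hs => ?_
  · rintro _ ⟨h, rfl⟩
    rw [hjj, generatorCLM_apply]
    exact IsDecayingSemigroup.tendsto_slope_exp_smul γ (tendsto_slope_generator hμ hdom h)
  · refine le_of_eq_of_le ?_ (hM s hs)
    rw [sub_sub, hjj]
    rfl

end StrongMarkovProcess

/-! ### The main theorem. -/

open StrongMarkovProcess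

theorem theorem1 {E Ω : Type*} [TopologicalSpace E] [LocallyCompactSpace E] [T2Space E]
    [SecondCountableTopology E] [MeasurableSpace E] [BorelSpace E] [MeasurableSpace Ω]
    (X : StrongMarkovProcess E Ω) (μ : Measure E) [IsProbabilityMeasure μ]
    (hμ : X.IsStationary μ)
    (γ : ℝ) (hγ : 0 < γ) (r : E → ℝ) (hr : MemLp r 2 μ)
    {H : Type*} [NormedAddCommGroup H] [InnerProductSpace ℝ H] [CompleteSpace H] [RKHS ℝ H E ℝ]
    (K : E → E → ℝ) (hK : IsKernelOf K H)
    (hKcont : Continuous fun p : E × E => K p.1 p.2)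
    (hKint : ∀ x, MemLp (fun z => K z x) 2 μ)
    (hproj : IsOrthProjOnto μ K H)
    (hdom : ∀ f : H, X.InDomain μ f) :
    -- the value function is well defined, as an element of `L²(μ)`
    (∀ᵐ x ∂μ, Integrable (fun p : Ω × ℝ => Real.exp (-γ * p.2) * r (X.path p.2.toNNReal p.1))
      ((X.law x).prod (volume.restrict (Ioi 0)))) ∧
    MemLp (X.valueFunction γ r) 2 μ ∧
    ∃ Vinf : H,
      -- `Vinf` is the unique equilibrium
      (∀ W : H, kernelOp μ K (X.bellman μ γ r W) = 0 ↔ W = Vinf) ∧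
      l2norm μ (⇑Vinf - X.valueFunction γ r) ≤ γ⁻¹ * l2norm μ (X.bellman μ γ r Vinf) ∧
      ∀ V₀ : H, ∃ V : ℝ → H,
        IsProjectedSolution X μ K γ r V₀ V ∧
        (∀ W : ℝ → H, IsProjectedSolution X μ K γ r V₀ W → EqOn W V (Ici 0)) ∧
        ∀ t : ℝ, 0 ≤ t →
          ‖V t - Vinf‖ ≤ Real.exp (-γ * t) * ‖V₀ - Vinf‖ ∧
          l2norm μ (⇑(V t) - X.valueFunction γ r) ≤
            Real.exp (-γ * t) * l2norm μ (⇑V₀ - ⇑Vinf) +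
              1 / γ * l2norm μ (X.bellman μ γ r Vinf) ∧
          BddAbove ((fun s => l2norm μ (kernelOp μ K (X.bellman μ γ r (V s)) -
            X.bellman μ γ r (V s))) '' Icc 0 t) ∧
          l2norm μ (⇑(V t) - X.valueFunction γ r) ≤
            Real.exp (-γ * t) * l2norm μ (⇑V₀ - X.valueFunction γ r) +
              (1 - Real.exp (-γ * t)) / γ *
                sSup ((fun s => l2norm μ (kernelOp μ K (X.bellman μ γ r (V s)) -
                  X.bellman μ γ r (V s))) '' Icc 0 t) := by
  set j := domainToL2 hdom with hj
  set rL := hr.toLp r with hrL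
  set bell : H → Lp ℝ 2 μ := bellmanL2 hμ hdom γ rL with hbell
  set M := projectedCLM hμ hdom γ with hMdef
  set vL := (memLp_valueFunction hμ hγ hr).toLp (X.valueFunction γ r) with hvL
  have hM := inner_projectedCLM_le hμ hdom γ
  have hjnorm : ∀ h, ‖j h‖ = ‖h‖ := norm_toL2 hK hproj
  have hjae : ∀ h : H, ⇑h =ᵐ[μ] j h := fun h => (RKHS.toL2_ae_eq _ h).symm
  have hvae : X.valueFunction γ r =ᵐ[μ] vL := (MemLp.coeFn_toLp _).symm
  have hproj_bell : ∀ h : H, j.adjoint (bell h) = M h + j.adjoint rL :=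
    adjoint_bellmanL2 hμ hdom hK hproj γ rL
  have hl2V : ∀ h : H, l2norm μ (⇑h - X.valueFunction γ r) = ‖j h - vL‖ := fun h =>
    l2norm_eq_norm (((hjae h).sub hvae).trans (Lp.coeFn_sub _ _).symm)
  have hl2b : ∀ h : H, l2norm μ (X.bellman μ γ r h) = ‖bell h‖ := fun h =>
    l2norm_eq_norm (bellman_ae_eq hμ hdom γ hr h)
  have hl2e : ∀ h : H, l2norm μ (kernelOp μ K (X.bellman μ γ r h) - X.bellman μ γ r h) =
      ‖j (j.adjoint (bell h)) - bell h‖ := fun h => by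
    rw [kernelOp_bellman hμ hdom hK γ hr]
    exact l2norm_eq_norm (((hjae _).sub (bellman_ae_eq hμ hdom γ hr h)).trans
      (Lp.coeFn_sub _ _).symm)
  have hcontε : Continuous fun h : H => ‖j (j.adjoint (bell h)) - bell h‖ := by
    have := continuous_bellmanL2 hμ hdom γ rL
    fun_prop
  have herr : ∀ V : ℝ → H, (∀ t, 0 ≤ t → HasDerivWithinAt V (M (V t) + j.adjoint rL) (Ici 0) t) →
      ∀ t B, 0 ≤ t → (∀ s ∈ Icc 0 t, ‖j (j.adjoint (bell (V s))) - bell (V s)‖ ≤ B) →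
      ‖j (V t) - vL‖ ≤ Real.exp (-γ * t) * ‖j (V 0) - vL‖ + (1 - Real.exp (-γ * t)) / γ * B :=
    fun V hV t B ht hB => norm_sub_valueFunction_le hμ hdom hK hproj hγ hr hV ht hB
  obtain ⟨w, hw⟩ := exists_forall_add_eq_zero_iff_of_dissipative hγ hM (j.adjoint rL)
  have hw0 : M w + j.adjoint rL = 0 := (hw w).2 rfl
  -- The error estimate for the constant path `w` at time `1`: absorbing `e^{-γ} ‖j w - vL‖` on the
  -- left leaves the factor `1 - e^{-γ}` on both sides. Any positive time would do.
  have hwV : ‖j w - vL‖ ≤ γ⁻¹ * ‖bell w‖ := by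
    have h1 := herr (fun _ => w) (fun t _ => by rw [hw0]; exact hasDerivWithinAt_const _ _ _)
      1 ‖bell w‖ zero_le_one fun s _ => by rw [hproj_bell, hw0, map_zero, zero_sub, norm_neg]
    have h2 : 0 < 1 - Real.exp (-γ * 1) := sub_pos.2 (Real.exp_lt_one_iff.2 (by linarith))
    refine le_of_mul_le_mul_left ?_ h2
    calc (1 - Real.exp (-γ * 1)) * ‖j w - vL‖
        ≤ (1 - Real.exp (-γ * 1)) / γ * ‖bell w‖ := by linarith
      _ = _ := by ring
  refine ⟨ae_integrable_discounted hμ hγ hr, memLp_valueFunction hμ hγ hr, w, fun W => ?_, ?_,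
    fun V₀ => ?_⟩
  · rw [← hw W, ← hproj_bell, kernelOp_bellman hμ hdom hK γ hr, ← RKHS.coe_zero (H := H)]
    exact DFunLike.coe_injective.eq_iff
  · rw [hl2V, hl2b]
    exact hwV
  obtain ⟨V, hV0, hV⟩ := exists_hasDerivAt_affine M hw0 V₀
  have hsol : ∀ W : ℝ → H, IsProjectedSolution X μ K γ r V₀ W ↔ W 0 = V₀ ∧ ∀ t, 0 ≤ t →
      HasDerivWithinAt W (M (W t) + j.adjoint rL) (Ici 0) t := fun W =>
    isProjectedSolution_iff hμ hdom hK hproj γ hr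
  have hVd : ∀ t, 0 ≤ t → HasDerivWithinAt V (M (V t) + j.adjoint rL) (Ici 0) t :=
    fun t _ => (hV t).hasDerivWithinAt
  refine ⟨V, (hsol V).2 ⟨hV0, hVd⟩, fun W hW t ht => ?_, fun t ht => ?_⟩
  · obtain ⟨hW0, hWd⟩ := (hsol W).1 hW
    -- The difference of two solutions solves the homogeneous equation from `0`, so it vanishes.
    have h1 := norm_le_exp_mul_of_dissipative hM (u := fun s => W s - V s) (fun s hs => by
      refine ((hWd s hs).sub (hVd s hs)).congr_deriv ?_
      rw [map_sub]
      abel) ht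
    simp only [hW0, hV0, sub_self, norm_zero, mul_zero] at h1
    exact sub_eq_zero.1 (norm_le_zero_iff.1 h1)
  have hstab : ‖V t - w‖ ≤ Real.exp (-γ * t) * ‖V₀ - w‖ := by
    have h1 := norm_le_exp_mul_of_dissipative hM (u := fun s => V s - w) (fun s hs => by
      refine ((hVd s hs).sub_const w).congr_deriv ?_
      rw [map_sub, eq_neg_of_add_eq_zero_left hw0]
      abel) ht
    simpa only [hV0] using h1
  have hbdd : BddAbove ((fun s => ‖j (j.adjoint (bell (V s))) - bell (V s)‖) '' Icc 0 t) := by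
    -- The projection error is continuous along the solution because the generator is bounded on
    -- `H`.
    refine (isCompact_Icc.image_of_continuousOn ?_).bddAbove
    exact hcontε.comp_continuousOn fun s _ => (hV s).continuousAt.continuousWithinAt
  simp only [hl2V, hl2b, hl2e]
  refine ⟨hstab, ?_, hbdd, ?_⟩
  · have h1 : l2norm μ (⇑V₀ - ⇑w) = ‖V₀ - w‖ := by
      rw [← RKHS.coe_sub, l2norm_eq_norm (hjae _), hjnorm]
    rw [h1]
    calc ‖j (V t) - vL‖ = ‖j (V t - w) + (j w - vL)‖ := by rw [map_sub]; congr 1; abel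
      _ ≤ ‖j (V t - w)‖ + ‖j w - vL‖ := norm_add_le _ _
      _ ≤ _ := by
        rw [hjnorm, one_div]
        exact add_le_add hstab hwV
  · have h1 := herr V hVd t _ ht fun s hs => le_csSup hbdd (mem_image_of_mem _ hs)
    rwa [hV0] at h1
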